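/- **Conventions.** A *bc-space* is a complex vector space with a convex bornology: a family of bounded sets that covers the space, is stable under subsets, finite unions, sums and homotheties, and in which every bounded set lies in a bounded convex circled set. A linear map is *bounded* if it sends bounded sets to bounded sets. A *DFN-space* is a bc-space that is the inductive limit of a sequence $V_0\to V_1\to\cdots$ of Banach spaces with injective $\mathbb{C}$-nuclear transition maps (so it is the union of the $V_n$, and its bounded sets are the bounded subsets of the various $V_n$). A *DFN-algebra* is a unital associative $\mathbb{C}$-algebra $A$ with a bornology making it a DFN-space and its multiplication bounded. $\mathrm{Mod}^{dfn}(A)$ is the additive category whose objects are the (left) $A$-modules that are DFN-spaces with bounded action $A\times E\to E$, and whose morphisms are the bounded $A$-linear maps. A sequence of maps $\{\varphi_k\}$ from $E$ to $F$ is *bounded* if for each bounded $B\subset E$ the set $\bigcup_k\varphi_k(B)$ is bounded in $F$. A bounded $A$-linear map $u\colon E\to F$ is *$A$-nuclear* if there are a bounded sequence $\{y_k\}$ in $F$, a bounded sequence $\{\varphi_k\}$ of bounded $A$-linear maps $E\to A$ and a summable sequence $\{\lambda_k\}$ in $\mathbb{R}_{\ge 0}$ with $u(x)=\sum_k\lambda_k\,\varphi_k(x)\,y_k$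 for all $x\in E$ (bornological convergence). For Banach spaces, with $A=\mathbb{C}$ and the norm bornologies, this defines $\mathbb{C}$-nuclear maps. For an additive category $\mathcal{C}$ and integers $a\le b$, $C^{[a,b]}(\mathcal{C})$ is the category of complexes in $\mathcal{C}$ concentrated in degrees $[a,b]$, $K^{[a,b]}(\mathcal{C})$ is the category with the same objects and with homotopy classes of morphisms of complexes as morphisms, $\mathrm{Ind}(\mathcal{C})$ is the category of ind-objects of $\mathcal{C}$, and $``\varinjlim_n"X_n\in\mathrm{Ind}(\mathcal{C})$ is the ind-object defined by an inductive system $\{X_n\}_n$ in $\mathcal{C}$. **Theorem 4.4.** Let $A$ be a DFN-algebra, let $a\le b$ be integers, and let $\{E^\bullet_n,u^\bullet_n\}_{n\in\mathbb{N}}$ be an inductive system in $C^{[a,b]}(\mathrm{Mod}^{dfn}(A))$. Assume that (i) for each $i\in\mathbb{Z}$ and $n\in\mathbb{N}$ the map $u^i_n\colon E^i_n\to E^i_{n+1}$ is $A$-nuclear; (ii) for each $i\in\mathbb{Z}$, $``\varinjlim_n"H^i(E^\bullet_n)\simeq 0$ in $\mathrm{Ind}(\mathrm{Mod}(\mathbb{C}))$,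 where $H^i(E^\bullet_n)$ is the cohomology of the underlying complex of complex vector spaces. Then $``\varinjlim_n"E^\bullet_n\simeq 0$ in $\mathrm{Ind}\bigl(K^{[a,b]}(\mathrm{Mod}^{dfn}(A))\bigr)$. -/

import Mathlib

open CategoryTheory CategoryTheory.Limits Bornology
open scoped Pointwise

universe v u

/-! ### Convex bornological vector spaces, algebras and modules -/

/-- A convex bornology on a complex vector space (`bc`-space): the bounded sets are stable under
sums and homotheties, and every bounded set is contained in a bounded convex circled set.
(Being a bornology, i.e. covering the space and being stable under subsets and finite unions, is
part of `Bornology E`.) -/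
class IsConvexBornology (E : Type*) [AddCommGroup E] [Module ℂ E] [Bornology E] : Prop where
  isBounded_add : ∀ {s t : Set E}, IsBounded s → IsBounded t → IsBounded (s + t)
  isBounded_smul : ∀ (c : ℂ) {s : Set E}, IsBounded s → IsBounded (c • s)
  exists_convex_circled : ∀ {s : Set E}, IsBounded s →
    ∃ t : Set E, s ⊆ t ∧ IsBounded t ∧ Balanced ℂ t ∧ Convex ℝ t

/-- The action of `A` on `E` is bounded as a bilinear map `A × E → E`. -/
class IsBoundedAction (A E : Type*) [SMul A E] [Bornology A] [Bornology E] : Prop where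
  isBounded_smul_set : ∀ {s : Set A} {t : Set E}, IsBounded s → IsBounded t → IsBounded (s • t)

/-- A map between bornological sets is bounded if it maps bounded sets to bounded sets. -/
def IsBoundedMap {E F : Type*} [Bornology E] [Bornology F] (f : E → F) : Prop :=
  ∀ s : Set E, IsBounded s → IsBounded (f '' s)

/-- A sequence of maps `E → F` is bounded if, for every bounded `s ⊆ E`, the sets `f n '' s` are
contained in a common bounded subset of `F`. -/
def IsBoundedSeqOfMaps {E F : Type*} [Bornology E] [Bornology F] (f : ℕ → E → F) : Prop :=
  ∀ s : Set E, IsBounded s → IsBounded (⋃ n, f n '' s)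

/-- Convergence of a sequence in a convex bornological space: there is a bounded convex circled
set `B` such that `s N - x` tends to zero for the gauge of `B`. -/
def BornologicalTendsto {E : Type*} [AddCommGroup E] [Module ℂ E] [Bornology E]
    (s : ℕ → E) (x : E) : Prop :=
  ∃ B : Set E, IsBounded B ∧ Balanced ℂ B ∧ Convex ℝ B ∧
    ∀ ε : ℝ, 0 < ε → ∀ᶠ N in Filter.atTop, s N - x ∈ (ε : ℂ) • B

/-- A bounded `A`-linear map `u : E → F` is `A`-nuclear if `u x = ∑ λ n • (φ n x • y n)` for a
bounded sequence `y` in `F`, a bounded sequence `φ` of bounded `A`-linear maps `E → A`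
and a summable sequence `λ` of nonnegative real numbers. -/
def IsNuclearMap (A : Type*) {E F : Type*} [Ring A] [Bornology A]
    [AddCommGroup E] [Module A E] [Bornology E]
    [AddCommGroup F] [Module A F] [Module ℂ F] [Bornology F] (u : E →ₗ[A] F) : Prop :=
  IsBoundedMap u ∧
  ∃ (l : ℕ → ℝ) (φ : ℕ → E →ₗ[A] A) (y : ℕ → F),
    (∀ n, 0 ≤ l n) ∧ Summable l ∧
    (∀ n, IsBoundedMap (φ n)) ∧ IsBoundedSeqOfMaps (fun n => (φ n : E → A)) ∧
    IsBounded (Set.range y) ∧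
    ∀ x : E, BornologicalTendsto
      (fun N => ∑ n ∈ Finset.range N, (l n : ℂ) • (φ n x • y n)) (u x)

/-! ### DFN-spaces, DFN-algebras and DFN-modules -/

/-- A presentation of the bornological vector space `E` as the inductive limit of a sequence of
Banach spaces with injective `ℂ`-nuclear transition maps: `E` is the increasing union of the
(images of the) Banach spaces `V n`, and its bounded sets are the subsets of the images of the
bounded sets of the `V n`. -/
structure DFNPresentation (E : Type v) [AddCommGroup E] [Module ℂ E] [Bornology E] where
  /-- The Banach spaces of the sequence. -/
  V : ℕ → Type v
  [normedAddCommGroup : ∀ n, NormedAddCommGroup (V n)]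
  [normedSpace : ∀ n, NormedSpace ℂ (V n)]
  [completeSpace : ∀ n, CompleteSpace (V n)]
  /-- The transition maps. -/
  map : ∀ n, V n →ₗ[ℂ] V (n + 1)
  map_injective : ∀ n, Function.Injective (map n)
  map_nuclear : ∀ n, IsNuclearMap ℂ (map n)
  /-- The canonical maps to the inductive limit. -/
  ι : ∀ n, V n →ₗ[ℂ] E
  ι_map : ∀ n x, ι (n + 1) (map n x) = ι n x
  ι_injective : ∀ n, Function.Injective (ι n)
  exists_ι_eq : ∀ x : E, ∃ n, ∃ z : V n, ι n z = x
  isBounded_iff : ∀ s : Set E,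
    IsBounded s ↔ ∃ n, ∃ t : Set (V n), IsBounded t ∧ s ⊆ ι n '' t

/-- A DFN-space: a convex bornological space which is the inductive limit of a sequence of Banach
spaces with injective nuclear transition maps. -/
class IsDFNSpace (E : Type v) [AddCommGroup E] [Module ℂ E] [Bornology E] : Prop
    extends IsConvexBornology E where
  nonempty_presentation : Nonempty (DFNPresentation E)

/-- A DFN-algebra: a (unital associative) `ℂ`-algebra with a bornology for which
it is a DFN-space and the multiplication is bounded. -/
class IsDFNAlgebra (A : Type u) [Ring A] [Algebra ℂ A] [Bornology A] : Prop
    extends IsDFNSpace A, IsBoundedAction A A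

/-- The objects of the category of DFN-modules over `A`: bornological (left) `A`-modules whose
underlying bornological vector space is a DFN-space. -/
structure DFNMod (A : Type u) [Ring A] [Algebra ℂ A] [Bornology A] : Type (max u (v + 1)) where
  /-- The underlying set. -/
  carrier : Type v
  [addCommGroup : AddCommGroup carrier]
  [moduleC : Module ℂ carrier]
  [module : Module A carrier]
  [isScalarTower : IsScalarTower ℂ A carrier]
  [bornology : Bornology carrier]
  [isBoundedAction : IsBoundedAction A carrier]
  [isDFNSpace : IsDFNSpace carrier]

namespace DFNMod

attribute [instance] addCommGroup moduleC module isScalarTower bornology isBoundedAction isDFNSpace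

/-- The group of bounded `A`-linear maps between two bornological `A`-modules. -/
def boundedHom (A E F : Type*) [Ring A] [AddCommGroup E] [Module A E] [Bornology E]
    [AddCommGroup F] [Module A F] [Module ℂ F] [Bornology F] [IsConvexBornology F] :
    AddSubgroup (E →ₗ[A] F) where
  carrier := {f | IsBoundedMap f}
  zero_mem' := fun s _ => (isBounded_singleton (x := (0 : F))).subset (by
    rintro _ ⟨x, _, rfl⟩
    simp)
  add_mem' := fun {f g} hf hg s hs =>
    (IsConvexBornology.isBounded_add (hf s hs) (hg s hs)).subset (by
      rintro _ ⟨x, hx, rfl⟩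
      exact Set.add_mem_add ⟨x, hx, rfl⟩ ⟨x, hx, rfl⟩)
  neg_mem' := fun {f} hf s hs =>
    (IsConvexBornology.isBounded_smul (-1 : ℂ) (hf s hs)).subset (by
      rintro _ ⟨x, hx, rfl⟩
      exact ⟨f x, ⟨x, hx, rfl⟩, by simp⟩)

variable {A : Type u} [Ring A] [Algebra ℂ A] [Bornology A]

/-- Morphisms of DFN-modules are the bounded `A`-linear maps. -/
@[ext]
structure Hom (E F : DFNMod.{v} A) : Type v where
  /-- The underlying bounded linear map. -/
  val : boundedHom A E.carrier F.carrier

/-- The linear map underlying a morphism of DFN-modules. -/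
def Hom.linearMap {E F : DFNMod.{v} A} (f : Hom E F) : E.carrier →ₗ[A] F.carrier := f.val.1

theorem Hom.isBoundedMap {E F : DFNMod.{v} A} (f : Hom E F) : IsBoundedMap f.linearMap := f.val.2

theorem Hom.ext_linearMap {E F : DFNMod.{v} A} {f g : Hom E F} (h : f.linearMap = g.linearMap) :
    f = g :=
  Hom.ext (Subtype.ext h)

instance : Category.{v} (DFNMod.{v} A) where
  Hom E F := Hom E F
  id E := ⟨⟨LinearMap.id, fun s hs => by simpa using hs⟩⟩
  comp f g := ⟨⟨g.linearMap ∘ₗ f.linearMap, fun s hs => by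
    have h := g.isBoundedMap _ (f.isBoundedMap s hs)
    rw [Set.image_image] at h
    exact h⟩⟩

/-- Morphisms are identified with bounded linear maps. -/
def homEquiv (E F : DFNMod.{v} A) : (E ⟶ F) ≃ boundedHom A E.carrier F.carrier where
  toFun f := Hom.val f
  invFun f := Hom.mk f

instance (E F : DFNMod.{v} A) : AddCommGroup (E ⟶ F) := (homEquiv E F).addCommGroup

theorem linearMap_id (E : DFNMod.{v} A) : Hom.linearMap (𝟙 E) = LinearMap.id := rfl

theorem linearMap_comp {E F G : DFNMod.{v} A} (f : E ⟶ F) (g : F ⟶ G) :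
    Hom.linearMap (f ≫ g) = Hom.linearMap g ∘ₗ Hom.linearMap f := rfl

theorem linearMap_add {E F : DFNMod.{v} A} (f g : E ⟶ F) :
    Hom.linearMap (f + g) = Hom.linearMap f + Hom.linearMap g := rfl

instance : Preadditive (DFNMod.{v} A) where
  add_comp E F G f f' g := Hom.ext_linearMap <| by
    simp only [linearMap_comp, linearMap_add, LinearMap.comp_add]
  comp_add E F G f g g' := Hom.ext_linearMap <| by
    simp only [linearMap_comp, linearMap_add, LinearMap.add_comp]

/-- The functor sending a DFN-module to the underlying complex vector space. -/
def toModuleCat (A : Type u) [Ring A] [Algebra ℂ A] [Bornology A] :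
    DFNMod.{v} A ⥤ ModuleCat.{v} ℂ where
  obj E := ModuleCat.of ℂ E.carrier
  map f := ModuleCat.ofHom (Hom.linearMap f |>.restrictScalars ℂ)

instance : (toModuleCat.{v} A).Additive where
  map_add := rfl

end DFNMod

/-! ### Bounded complexes, their homotopy category, and formal inductive limits -/

section Complexes

variable (C : Type u) [Category.{v} C] [Preadditive C]

/-- The complexes concentrated in degrees `[a, b]`. -/
def concentratedIn (a b : ℤ) : ObjectProperty (CochainComplex C ℤ) :=
  fun K => ∀ i : ℤ, i ∉ Set.Icc a b → IsZero (K.X i)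

/-- The category `C^{[a, b]}(C)` of complexes in `C` concentrated in degrees `[a, b]`. -/
abbrev ComplexIcc (a b : ℤ) : Type (max u v) := (concentratedIn C a b).FullSubcategory

/-- The homotopy category `K^{[a, b]}(C)`: the full subcategory of the homotopy category of
complexes in `C` whose objects are the complexes concentrated in degrees `[a, b]`. -/
abbrev HomotopyIcc (a b : ℤ) : Type (max u v) :=
  ObjectProperty.FullSubcategory
    (fun K : HomotopyCategory C (ComplexShape.up ℤ) => concentratedIn C a b K.as)

/-- The canonical functor from `C^{[a, b]}(C)` to `K^{[a, b]}(C)`. -/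
def toHomotopyIcc (a b : ℤ) : ComplexIcc C a b ⥤ HomotopyIcc C a b :=
  ObjectProperty.lift _
    ((concentratedIn C a b).ι ⋙ HomotopyCategory.quotient C (ComplexShape.up ℤ))
    (fun K => K.property)

end Complexes

instance (C : Type u) [Category.{v} C] : HasColimitsOfShape ℕ (Ind C) :=
  haveI : HasColimitsOfShape (AsSmall.{v} ℕ) (Ind C) :=
    HasFilteredColimitsOfSize.HasColimitsOfShape _
  hasColimitsOfShape_of_equivalence (AsSmall.equiv (C := ℕ)).symm

/-- The ind-object `"lim" X n` of `C` defined by an inductive system `X` in `C` indexed by `ℕ`: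
the colimit of `X` computed in the category of ind-objects. -/
noncomputable def indLim {C : Type u} [Category.{v} C] (X : ℕ ⥤ C) : Ind C :=
  colimit (X ⋙ Ind.yoneda)

/-- The functor `H^i` from `C^{[a, b]}` of DFN-modules over `A` to complex vector spaces: the
cohomology of the underlying (algebraic) complex. -/
noncomputable def dfnCohomology (A : Type u) [Ring A] [Algebra ℂ A] [Bornology A]
    (a b i : ℤ) : ComplexIcc (DFNMod.{v} A) a b ⥤ ModuleCat.{v} ℂ :=
  (concentratedIn (DFNMod.{v} A) a b).ι ⋙
    (DFNMod.toModuleCat.{v} A).mapHomologicalComplex (ComplexShape.up ℤ) ⋙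
    HomologicalComplex.homologyFunctor (ModuleCat.{v} ℂ) (ComplexShape.up ℤ) i

/-!
# Nuclear inductive systems of complexes of DFN-modules with vanishing cohomology

A formal inductive limit `"lim" X n` vanishes if and only if every `X n` is killed by some transition
map `X n ⟶ X m` (`isZero_indLim_iff`): the set of sections of `"lim" X n` over `Z` is the inductive
limit of the sets of maps `Z ⟶ X n`, so over `Z = X n` the identity and the zero map must become
equal. Hence every cocycle of `E n` becomes a coboundary in some `E m`, uniformly in the cocycle,
and it has to be shown that every `E n ⟶ E m` with `m` large is homotopic to zero through bounded
`A`-linear maps.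

The homotopy is built by descending induction on the degree (`exists_nullHomotopicFrom_pred`). If
it is known in degrees above `j`, what is left of the transition map in degree `j` takes its values
in the cocycles, so after one more transition it takes its values in the image of the differential.
It then remains to lift a map through the differential, and nuclearity permits this after
composition with one transition map on the source side (`IsNuclearMap.exists_lift`). Indeed, if
`u x = ∑ l k • (φ k x • y k)` and the vectors `f (y k)` have preimages `g k` under `d` which form a
bounded sequence, then `x ↦ ∑ l k • (φ k x • g k)` is a bounded `A`-linear lift of `f ∘ u`.

Bounded sequences of preimages exist by Baire's theorem (`exists_isBounded_range_lift`): the `y k`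
are bounded in a Banach space `W` of a presentation of their DFN-space, and `W` is the union of the
images of its fibre products with the Banach spaces of a presentation of the source of `d`. These
fibre products are Banach spaces, because DFN-spaces are separated, so one of them is mapped onto
`W`, and the open mapping theorem bounds the preimages.
-/

attribute [instance] DFNPresentation.normedAddCommGroup DFNPresentation.normedSpace
  DFNPresentation.completeSpace

/-! ### The open mapping theorem for a countable family of Banach spaces -/

section Banach

variable {W : Type*} [NormedAddCommGroup W] [NormedSpace ℂ W]

/-- The successive approximation step of the open mapping theorem. -/
theorem ContinuousLinearMap.exists_preimage_norm_le_of_approx {P : Type*} [NormedAddCommGroup P]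
    [NormedSpace ℂ P] [CompleteSpace P] (T : P →L[ℂ] W) {C : ℝ} (hC : 0 ≤ C)
    (h : ∀ y : W, ∃ x : P, ‖y - T x‖ ≤ 1 / 2 * ‖y‖ ∧ ‖x‖ ≤ C * ‖y‖) (y : W) :
    ∃ x : P, T x = y ∧ ‖x‖ ≤ 2 * C * ‖y‖ := by
  choose g hg hgC using h
  -- `r n` is the part of `y` which is not yet reached after `n` approximations
  let r : ℕ → W := fun n => (fun z => z - T (g z))^[n] y
  have hr_succ : ∀ n, r (n + 1) = r n - T (g (r n)) := fun n =>
    Function.iterate_succ_apply' _ n y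
  have hr : ∀ n, ‖r n‖ ≤ (1 / 2) ^ n * ‖y‖ := by
    intro n
    induction n with
    | zero => simp [r]
    | succ n ih =>
      rw [hr_succ, pow_succ', mul_assoc]
      exact (hg _).trans (by gcongr)
  have hx : ∀ n, ‖g (r n)‖ ≤ (1 / 2) ^ n * (C * ‖y‖) := fun n =>
    (hgC _).trans (by
      calc C * ‖r n‖ ≤ C * ((1 / 2) ^ n * ‖y‖) := by gcongr; exact hr n
        _ = _ := by ring)
  have hgeom : HasSum (fun n : ℕ => (1 / 2 : ℝ) ^ n * (C * ‖y‖)) (2 * (C * ‖y‖)) :=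
    hasSum_geometric_two.mul_right _
  have hs : Summable fun n => g (r n) := Summable.of_norm_bounded hgeom.summable hx
  refine ⟨∑' n, g (r n), ?_, by
    rw [mul_assoc]; exact tsum_of_norm_bounded hgeom hx⟩
  have hpart : ∀ n, T (∑ k ∈ Finset.range n, g (r k)) = y - r n := by
    intro n
    induction n with
    | zero => simp [r]
    | succ n ih => rw [Finset.sum_range_succ, map_add, ih, hr_succ]; abel
  have h1 := (T.continuous.tendsto _).comp hs.hasSum.tendsto_sum_nat
  have h2 : Filter.Tendsto r Filter.atTop (nhds 0) :=
    squeeze_zero_norm hr (by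
      simpa using (tendsto_pow_atTop_nhds_zero_of_lt_one (r := (1 / 2 : ℝ))
        (by norm_num) (by norm_num)).mul_const ‖y‖)
  have h3 : Filter.Tendsto (fun n => y - r n) Filter.atTop (nhds y) := by
    simpa using h2.const_sub y
  exact tendsto_nhds_unique h1 (by simpa only [Function.comp_def, hpart] using h3)

/-- If the closure of the image of a ball has nonempty interior, then every vector has a preimage
of controlled norm. -/
theorem ContinuousLinearMap.exists_preimage_norm_le_of_mem_interior {P : Type*}
    [NormedAddCommGroup P] [NormedSpace ℂ P] [CompleteSpace P] (T : P →L[ℂ] W) {R : ℝ} {a : W}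
    (ha : a ∈ interior (closure (T '' Metric.ball 0 R))) :
    ∃ C : ℝ, ∀ y : W, ∃ x : P, T x = y ∧ ‖x‖ ≤ C * ‖y‖ := by
  obtain ⟨ε, hε, hball⟩ := Metric.mem_nhds_iff.1 (mem_interior_iff_mem_nhds.1 ha)
  have hR : 0 ≤ R := by
    by_contra hR
    rw [Metric.ball_eq_empty.2 (not_le.1 hR).le] at hball
    simpa using hball (Metric.mem_ball_self hε)
  -- a vector of norm `ε / 2` is half the difference of two vectors of the ball around `a`
  have key : ∀ w : W, ‖w‖ < ε → ∃ x : P, ‖w - T x‖ ≤ ε / 4 ∧ ‖x‖ ≤ R := by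
    intro w hw
    obtain ⟨_, ⟨x₁, hx₁, rfl⟩, h₁⟩ := Metric.mem_closure_iff.1
      (hball (show a + w ∈ Metric.ball a ε by simpa using hw)) (ε / 4) (by positivity)
    obtain ⟨_, ⟨x₂, hx₂, rfl⟩, h₂⟩ := Metric.mem_closure_iff.1
      (hball (show a - w ∈ Metric.ball a ε by simpa using hw)) (ε / 4) (by positivity)
    rw [dist_eq_norm] at h₁ h₂
    rw [mem_ball_zero_iff] at hx₁ hx₂
    have h2 : ‖(2⁻¹ : ℂ)‖ = 2⁻¹ := by simp
    refine ⟨(2⁻¹ : ℂ) • (x₁ - x₂), ?_, ?_⟩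
    · have : w - T ((2⁻¹ : ℂ) • (x₁ - x₂)) = (2⁻¹ : ℂ) • ((a + w - T x₁) - (a - w - T x₂)) := by
        rw [map_smul, map_sub]
        have : w = (2⁻¹ : ℂ) • (w + w) := by rw [← two_smul ℂ w, smul_smul]; norm_num
        nth_rewrite 1 [this]
        rw [← smul_sub]
        congr 1
        abel
      rw [this, norm_smul, h2]
      linarith [norm_sub_le (a + w - T x₁) (a - w - T x₂)]
    · rw [norm_smul, h2]
      linarith [norm_sub_le x₁ x₂]
  have hC : 0 ≤ R * (2 / ε) := by positivity
  refine ⟨2 * (R * (2 / ε)), T.exists_preimage_norm_le_of_approx hC fun y => ?_⟩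
  rcases eq_or_ne y 0 with rfl | hy
  · exact ⟨0, by simp⟩
  have hy' : 0 < ‖y‖ := norm_pos_iff.2 hy
  let c : ℝ := ε / 2 / ‖y‖
  have hc : 0 < c := by positivity
  have hcy : c * ‖y‖ = ε / 2 := by simp only [c]; field_simp
  have hc0 : (c : ℂ) ≠ 0 := by exact_mod_cast hc.ne'
  have hnc : ‖(c : ℂ)‖ = c := by simp [abs_of_pos hc]
  obtain ⟨x, hx, hxR⟩ := key ((c : ℂ) • y) (by rw [norm_smul, hnc, hcy]; linarith)
  refine ⟨(c : ℂ)⁻¹ • x, ?_, ?_⟩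
  · have : y - T ((c : ℂ)⁻¹ • x) = (c : ℂ)⁻¹ • ((c : ℂ) • y - T x) := by
      rw [smul_sub, inv_smul_smul₀ hc0, map_smul]
    rw [this, norm_smul, norm_inv, hnc, inv_mul_le_iff₀ hc]
    linarith
  · rw [norm_smul, norm_inv, hnc, inv_mul_le_iff₀ hc]
    have : c * (R * (2 / ε) * ‖y‖) = R * (2 / ε) * (c * ‖y‖) := by ring
    rw [this, hcy]
    have : R * (2 / ε) * (ε / 2) = R := by field_simp
    rwa [this]

/-- If a Banach space is covered by the ranges of countably many continuous linear maps from
Banach spaces, then one of these maps is onto, with controlled norms of preimages. -/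
theorem ContinuousLinearMap.exists_preimage_norm_le_of_cover [CompleteSpace W] {P : ℕ → Type*}
    [∀ j, NormedAddCommGroup (P j)] [∀ j, NormedSpace ℂ (P j)] [∀ j, CompleteSpace (P j)]
    (T : ∀ j, P j →L[ℂ] W) (hT : ∀ w, ∃ j x, T j x = w) :
    ∃ (j : ℕ) (C : ℝ), ∀ w : W, ∃ x : P j, T j x = w ∧ ‖x‖ ≤ C * ‖w‖ := by
  have hcover : ⋃ p : ℕ × ℕ, closure (T p.1 '' Metric.ball 0 p.2) = Set.univ := by
    refine Set.eq_univ_of_forall fun w => ?_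
    obtain ⟨j, x, rfl⟩ := hT w
    obtain ⟨n, hn⟩ := exists_nat_gt ‖x‖
    exact Set.mem_iUnion.2 ⟨(j, n), subset_closure ⟨x, by simpa using hn, rfl⟩⟩
  obtain ⟨⟨j, n⟩, a, ha⟩ :=
    nonempty_interior_of_iUnion_of_closed (fun _ => isClosed_closure) hcover
  exact ⟨j, (T j).exists_preimage_norm_le_of_mem_interior ha⟩

end Banach

/-! ### Convergence in DFN-spaces -/

section Convergence

variable {E F : Type*} [AddCommGroup E] [Module ℂ E] [Bornology E]
  [AddCommGroup F] [Module ℂ F] [Bornology F]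

theorem BornologicalTendsto.of_isBounded [IsConvexBornology E] {s : ℕ → E} {x : E} {B : Set E}
    (hB : IsBounded B)
    (h : ∀ ε : ℝ, 0 < ε → ∀ᶠ N in Filter.atTop, s N - x ∈ (ε : ℂ) • B) :
    BornologicalTendsto s x := by
  obtain ⟨t, hBt, ht, hbal, hconv⟩ := IsConvexBornology.exists_convex_circled hB
  exact ⟨t, ht, hbal, hconv, fun ε hε =>
    (h ε hε).mono fun _ hN => Set.smul_set_mono hBt hN⟩

theorem BornologicalTendsto.const [IsConvexBornology E] (x : E) :
    BornologicalTendsto (fun _ => x) x :=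
  .of_isBounded (isBounded_singleton (x := (0 : E))) (by simp)

theorem BornologicalTendsto.map [IsConvexBornology F] {s : ℕ → E} {x : E}
    (h : BornologicalTendsto s x) (f : E →ₗ[ℂ] F) (hf : IsBoundedMap f) :
    BornologicalTendsto (fun N => f (s N)) (f x) := by
  obtain ⟨B, hB, -, -, h⟩ := h
  refine .of_isBounded (hf B hB) fun ε hε => (h ε hε).mono ?_
  rintro N ⟨z, hz, hN⟩
  exact ⟨f z, ⟨z, hz, rfl⟩, by
    rw [← map_sub, ← hN]
    exact (map_smul f _ _).symm⟩

theorem BornologicalTendsto.add [IsConvexBornology E] {s s' : ℕ → E} {x x' : E}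
    (h : BornologicalTendsto s x) (h' : BornologicalTendsto s' x') :
    BornologicalTendsto (fun N => s N + s' N) (x + x') := by
  obtain ⟨B, hB, -, -, h⟩ := h
  obtain ⟨B', hB', -, -, h'⟩ := h'
  refine .of_isBounded (IsConvexBornology.isBounded_add hB hB') fun ε hε => ?_
  filter_upwards [h ε hε, h' ε hε] with N hN hN'
  rw [smul_add, add_sub_add_comm]
  exact Set.add_mem_add hN hN'

theorem Filter.Tendsto.bornologicalTendsto {V : Type*} [NormedAddCommGroup V] [NormedSpace ℂ V]
    {s : ℕ → V} {x : V} (h : Filter.Tendsto s Filter.atTop (nhds x)) :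
    BornologicalTendsto s x := by
  refine ⟨Metric.closedBall 0 1, Metric.isBounded_closedBall, balanced_closedBall_zero,
    convex_closedBall 0 1, fun ε hε => ?_⟩
  filter_upwards [Metric.tendsto_nhds.1 h ε hε] with N hN
  rw [smul_closedBall _ _ zero_le_one]
  simpa [dist_eq_norm, abs_of_pos hε] using (dist_eq_norm (s N) x ▸ hN).le

namespace DFNPresentation

variable (D : DFNPresentation E)

/-- A bounded set is contained in the image of a ball of one of the Banach spaces. -/
theorem exists_subset_image_closedBall {s : Set E} (hs : IsBounded s) :
    ∃ (n : ℕ) (R : ℝ), 0 ≤ R ∧ s ⊆ D.ι n '' Metric.closedBall 0 R := by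
  obtain ⟨n, t, ht, hst⟩ := (D.isBounded_iff s).1 hs
  obtain ⟨R, hR⟩ := ht.subset_closedBall 0
  exact ⟨n, max R 0, le_max_right _ _, hst.trans
    (Set.image_mono (hR.trans (Metric.closedBall_subset_closedBall (le_max_left _ _))))⟩

theorem isBoundedMap_ι (n : ℕ) : IsBoundedMap (D.ι n) := fun t ht =>
  (D.isBounded_iff _).2 ⟨n, t, ht, subset_rfl⟩

end DFNPresentation

/-- A DFN-space is separated. -/
theorem BornologicalTendsto.unique [IsDFNSpace E] {s : ℕ → E} {x x' : E}
    (h : BornologicalTendsto s x) (h' : BornologicalTendsto s x') : x = x' := by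
  obtain ⟨D⟩ := IsDFNSpace.nonempty_presentation (E := E)
  obtain ⟨B, hB, -, -, h⟩ := h
  obtain ⟨B', hB', -, -, h'⟩ := h'
  obtain ⟨n, R, hR, hsub⟩ := D.exists_subset_image_closedBall (hB.union hB')
  have key : ∀ ε : ℝ, 0 < ε → ∃ z : D.V n, D.ι n z = x' - x ∧ ‖z‖ ≤ ε * (2 * R) := by
    intro ε hε
    obtain ⟨N, hN, hN'⟩ := ((h ε hε).and (h' ε hε)).exists
    obtain ⟨b, hb, hbN⟩ := hN
    obtain ⟨b', hb', hbN'⟩ := hN'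
    obtain ⟨z, hz, rfl⟩ := hsub (.inl hb)
    obtain ⟨z', hz', rfl⟩ := hsub (.inr hb')
    rw [mem_closedBall_zero_iff] at hz hz'
    refine ⟨(ε : ℂ) • (z - z'), ?_, ?_⟩
    · have e1 : (ε : ℂ) • D.ι n z = s N - x := hbN
      have e2 : (ε : ℂ) • D.ι n z' = s N - x' := hbN'
      rw [map_smul, map_sub, smul_sub, e1, e2]
      abel
    · rw [norm_smul, Complex.norm_real, Real.norm_of_nonneg hε.le]
      gcongr
      linarith [norm_sub_le z z']
  obtain ⟨z, hz, -⟩ := key 1 one_pos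
  have hz0 : ‖z‖ ≤ 0 := by
    refine le_of_forall_pos_le_add fun δ hδ => ?_
    obtain ⟨w, hw, hwδ⟩ := key (δ / (2 * R + 1)) (by positivity)
    rw [D.ι_injective n (hz.trans hw.symm)]
    refine hwδ.trans ?_
    rw [zero_add, div_mul_eq_mul_div, div_le_iff₀ (by positivity)]
    nlinarith
  rw [norm_le_zero_iff.1 hz0, map_zero] at hz
  exact (sub_eq_zero.1 hz.symm).symm

/-- Series with bounded terms and summable coefficients converge in a DFN-space, and their sums
stay in a bounded set which depends only on a bounded set containing the terms. -/
theorem exists_isBounded_forall_bornologicalTendsto_sum [IsDFNSpace E] {l : ℕ → ℝ}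
    (hl0 : ∀ k, 0 ≤ l k) (hl : Summable l) {S : Set E} (hS : IsBounded S) :
    ∃ S' : Set E, IsBounded S' ∧ ∀ w : ℕ → E, (∀ k, w k ∈ S) →
      ∃ x ∈ S', BornologicalTendsto (fun N => ∑ k ∈ Finset.range N, (l k : ℂ) • w k) x := by
  obtain ⟨D⟩ := IsDFNSpace.nonempty_presentation (E := E)
  obtain ⟨n, R, hR, hsub⟩ := D.exists_subset_image_closedBall hS
  refine ⟨_, D.isBoundedMap_ι n _ (Metric.isBounded_closedBall (x := 0) (r := (∑' k, l k) * R)),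
    fun w hw => ?_⟩
  choose z hz hzw using fun k => hsub (hw k)
  have hbound : ∀ k, ‖(l k : ℂ) • z k‖ ≤ l k * R := fun k => by
    rw [norm_smul, Complex.norm_real, Real.norm_of_nonneg (hl0 k)]
    exact mul_le_mul_of_nonneg_left (mem_closedBall_zero_iff.1 (hz k)) (hl0 k)
  have hlR : HasSum (fun k => l k * R) ((∑' k, l k) * R) := hl.hasSum.mul_right R
  have hsum : Summable fun k => (l k : ℂ) • z k := .of_norm_bounded hlR.summable hbound
  refine ⟨_, ⟨_, mem_closedBall_zero_iff.2 (tsum_of_norm_bounded hlR hbound), rfl⟩, ?_⟩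
  convert (hsum.hasSum.tendsto_sum_nat.bornologicalTendsto).map (D.ι n) (D.isBoundedMap_ι n)
    using 2 with N
  rw [map_sum]
  exact Finset.sum_congr rfl fun k _ => by rw [map_smul, hzw]

theorem isClosed_ker_of_isBoundedMap [IsDFNSpace F] {V : Type*} [NormedAddCommGroup V]
    [NormedSpace ℂ V] (q : V →ₗ[ℂ] F) (hq : IsBoundedMap q) :
    IsClosed (LinearMap.ker q : Set V) := by
  refine IsSeqClosed.isClosed fun s x hs hx => ?_
  have h := hx.bornologicalTendsto.map q hq
  have h0 : ∀ N, q (s N) = 0 := fun N => hs N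
  simp only [h0] at h
  exact h.unique (.const 0)

end Convergence

/-! ### Bounded lifts through a map of DFN-spaces -/

/-- A consequence of Baire's theorem: if the image of a bounded map `f` is contained in the image
of `d`, then the images under `f` of bounded sequences lift to bounded sequences. -/
theorem exists_isBounded_range_lift {E F G : Type*} [AddCommGroup E] [Module ℂ E] [Bornology E]
    [IsDFNSpace E] [AddCommGroup F] [Module ℂ F] [Bornology F] [IsDFNSpace F]
    [AddCommGroup G] [Module ℂ G] [Bornology G] [IsDFNSpace G]
    (f : E →ₗ[ℂ] F) (hf : IsBoundedMap f) (d : G →ₗ[ℂ] F) (hd : IsBoundedMap d)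
    (hfd : ∀ x, ∃ z, d z = f x) {y : ℕ → E} (hy : IsBounded (Set.range y)) :
    ∃ g : ℕ → G, IsBounded (Set.range g) ∧ ∀ k, d (g k) = f (y k) := by
  obtain ⟨DE⟩ := IsDFNSpace.nonempty_presentation (E := E)
  obtain ⟨DG⟩ := IsDFNSpace.nonempty_presentation (E := G)
  obtain ⟨n, R, hR, hsub⟩ := DE.exists_subset_image_closedBall hy
  -- the fibre product of `DE.V n` and `DG.V j` over `F` is the kernel of `q j`
  let q : ∀ j, DE.V n × DG.V j →ₗ[ℂ] F := fun j =>
    (f ∘ₗ DE.ι n) ∘ₗ LinearMap.fst ℂ _ _ - (d ∘ₗ DG.ι j) ∘ₗ LinearMap.snd ℂ _ _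
  have hq : ∀ j, IsBoundedMap (q j) := by
    intro j s hs
    have h1 := hf _ (DE.isBoundedMap_ι n _ hs.image_fst)
    have h2 := hd _ (DG.isBoundedMap_ι j _ hs.image_snd)
    refine (IsConvexBornology.isBounded_add h1
      (IsConvexBornology.isBounded_smul (-1 : ℂ) h2)).subset ?_
    rintro _ ⟨p, hp, rfl⟩
    refine ⟨f (DE.ι n p.1), ⟨_, ⟨_, ⟨p, hp, rfl⟩, rfl⟩, rfl⟩, (-1 : ℂ) • d (DG.ι j p.2),
      ⟨_, ⟨_, ⟨_, ⟨p, hp, rfl⟩, rfl⟩, rfl⟩, rfl⟩, ?_⟩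
    simp [q, sub_eq_add_neg]
  have hcomplete : ∀ j, CompleteSpace (LinearMap.ker (q j)) := fun j =>
    (isClosed_ker_of_isBoundedMap (q j) (hq j)).completeSpace_coe
  have hker : ∀ j (p : DE.V n × DG.V j), p ∈ LinearMap.ker (q j) ↔
      d (DG.ι j p.2) = f (DE.ι n p.1) := fun j p => by
    rw [LinearMap.mem_ker, eq_comm (a := d _), ← sub_eq_zero (a := f _)]
    rfl
  obtain ⟨j, C, hC⟩ := ContinuousLinearMap.exists_preimage_norm_le_of_cover
    (P := fun j => LinearMap.ker (q j))
    (fun j => (ContinuousLinearMap.fst ℂ (DE.V n) (DG.V j)).comp (LinearMap.ker (q j)).subtypeL)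
    (fun w => by
      obtain ⟨z, hz⟩ := hfd (DE.ι n w)
      obtain ⟨j, z', rfl⟩ := DG.exists_ι_eq z
      exact ⟨j, ⟨(w, z'), (hker j _).2 hz⟩, rfl⟩)
  choose w hw hwy using fun k => hsub (Set.mem_range_self k)
  choose p hp hpC using fun k => hC (w k)
  refine ⟨fun k => DG.ι j (p k).1.2, ?_, fun k => ?_⟩
  · refine (DG.isBoundedMap_ι j _
      (Metric.isBounded_closedBall (x := 0) (r := |C| * R))).subset ?_
    rintro _ ⟨k, rfl⟩
    refine ⟨_, mem_closedBall_zero_iff.2 ?_, rfl⟩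
    calc ‖(p k).1.2‖ ≤ ‖(p k).1‖ := norm_snd_le _
      _ ≤ C * ‖w k‖ := hpC k
      _ ≤ |C| * R := mul_le_mul (le_abs_self C) (mem_closedBall_zero_iff.1 (hw k))
          (norm_nonneg _) (abs_nonneg C)
  · have h1 : (p k).1.1 = w k := hp k
    rw [(hker j _).1 (p k).2, h1, hwy]

/-! ### Lifting nuclear maps -/

section Nuclear

variable {A : Type*} [Ring A] [Algebra ℂ A] [Bornology A]

/-- A bounded sequence of functionals, a bounded sequence of vectors and a summable sequence of
coefficients define a bounded `A`-linear map. -/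
theorem exists_linearMap_bornologicalTendsto {E G : Type*} [AddCommGroup E] [Module A E]
    [Bornology E] [AddCommGroup G] [Module A G] [Module ℂ G] [IsScalarTower ℂ A G] [Bornology G]
    [IsBoundedAction A G] [IsDFNSpace G] {l : ℕ → ℝ} (hl0 : ∀ k, 0 ≤ l k) (hl : Summable l)
    {φ : ℕ → E →ₗ[A] A} (hφ : IsBoundedSeqOfMaps (fun k => (φ k : E → A)))
    {g : ℕ → G} (hg : IsBounded (Set.range g)) :
    ∃ h : E →ₗ[A] G, IsBoundedMap h ∧ ∀ x, BornologicalTendsto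
      (fun N => ∑ k ∈ Finset.range N, (l k : ℂ) • (φ k x • g k)) (h x) := by
  have : SMulCommClass ℂ A G := IsScalarTower.to_smulCommClass
  have hbd : ∀ s : Set E, IsBounded s → ∃ S' : Set G, IsBounded S' ∧ ∀ x ∈ s, ∃ z ∈ S',
      BornologicalTendsto (fun N => ∑ k ∈ Finset.range N, (l k : ℂ) • (φ k x • g k)) z := by
    intro s hs
    obtain ⟨S', hS', h⟩ := exists_isBounded_forall_bornologicalTendsto_sum hl0 hl
      (IsBoundedAction.isBounded_smul_set (hφ s hs) hg)
    exact ⟨S', hS', fun x hx => h _ fun k =>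
      Set.smul_mem_smul (Set.mem_iUnion.2 ⟨k, x, hx, rfl⟩) (Set.mem_range_self k)⟩
  choose h hh using fun x : E =>
    show ∃ z : G, BornologicalTendsto
        (fun N => ∑ k ∈ Finset.range N, (l k : ℂ) • (φ k x • g k)) z by
      obtain ⟨S', -, H⟩ := hbd {x} isBounded_singleton
      obtain ⟨z, -, hz⟩ := H x rfl
      exact ⟨z, hz⟩
  refine ⟨{ toFun := h, map_add' := fun x x' => ?_, map_smul' := fun a x => ?_ }, ?_, hh⟩
  · refine (hh (x + x')).unique ?_
    convert (hh x).add (hh x') using 2 with N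
    rw [← Finset.sum_add_distrib]
    exact Finset.sum_congr rfl fun k _ => by rw [map_add, add_smul, smul_add]
  · refine (hh (a • x)).unique ?_
    have ha : IsBoundedMap (Module.toModuleEnd ℂ (S := A) G a) := fun s hs =>
      (IsBoundedAction.isBounded_smul_set (isBounded_singleton (x := a)) hs).subset (by
        rintro _ ⟨z, hz, rfl⟩
        exact Set.smul_mem_smul rfl hz)
    change BornologicalTendsto _ (Module.toModuleEnd ℂ (S := A) G a (h x))
    convert (hh x).map (Module.toModuleEnd ℂ (S := A) G a) ha using 2 with N
    rw [map_sum]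
    refine Finset.sum_congr rfl fun k _ => ?_
    rw [map_smul, smul_eq_mul, mul_smul, map_smul]
    rfl
  · intro s hs
    obtain ⟨S', hS', H⟩ := hbd s hs
    refine hS'.subset ?_
    rintro _ ⟨x, hx, rfl⟩
    obtain ⟨z, hz, hxz⟩ := H x hx
    change h x ∈ S'
    rwa [(hh x).unique hxz]

/-- If `u` is nuclear and the image of `f` is contained in the image of `d`, then `f ∘ u` lifts
through `d`. -/
theorem IsNuclearMap.exists_lift {E E' F G : Type*}
    [AddCommGroup E] [Module A E] [Bornology E]
    [AddCommGroup E'] [Module A E'] [Module ℂ E'] [IsScalarTower ℂ A E'] [Bornology E']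
    [IsDFNSpace E']
    [AddCommGroup F] [Module A F] [Module ℂ F] [IsScalarTower ℂ A F] [Bornology F] [IsDFNSpace F]
    [AddCommGroup G] [Module A G] [Module ℂ G] [IsScalarTower ℂ A G] [Bornology G]
    [IsBoundedAction A G] [IsDFNSpace G]
    {u : E →ₗ[A] E'} (hu : IsNuclearMap A u) (f : E' →ₗ[A] F) (hf : IsBoundedMap f)
    (d : G →ₗ[A] F) (hd : IsBoundedMap d) (hfd : ∀ x, ∃ z, d z = f x) :
    ∃ h : E →ₗ[A] G, IsBoundedMap h ∧ ∀ x, d (h x) = f (u x) := by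
  obtain ⟨-, l, φ, y, hl0, hl, -, hφ, hy, hsum⟩ := hu
  obtain ⟨g, hg, hgy⟩ := exists_isBounded_range_lift (f.restrictScalars ℂ) hf
    (d.restrictScalars ℂ) hd hfd hy
  obtain ⟨h, hh, hhsum⟩ := exists_linearMap_bornologicalTendsto hl0 hl hφ hg
  refine ⟨h, hh, fun x => ?_⟩
  have h1 := (hhsum x).map (d.restrictScalars ℂ) hd
  have h2 := (hsum x).map (f.restrictScalars ℂ) hf
  refine h1.unique ?_
  change BornologicalTendsto _ (f.restrictScalars ℂ (u x))
  convert h2 using 2 with N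
  simp only [map_sum, map_smul]
  refine Finset.sum_congr rfl fun k _ => ?_
  simp only [LinearMap.coe_restrictScalars, map_smul] at hgy ⊢
  rw [hgy]

end Nuclear

/-! ### Vanishing of formal inductive limits -/

section IndLim

variable {C : Type u} [Category.{v} C]

instance : PreservesColimitsOfShape ℕ (Ind.inclusion C) :=
  haveI : PreservesColimitsOfShape (AsSmall.{v} ℕ) (Ind.inclusion C) := inferInstance
  preservesColimitsOfShape_of_equiv (AsSmall.equiv (C := ℕ)).symm _

/-- Maps from `Z` to the terms of `X`, as sections over `Z` of the presheaves that these terms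
represent. -/
noncomputable def sectionsIso (X : ℕ ⥤ C) (Z : C) :
    X ⋙ coyoneda.obj (Opposite.op Z) ≅
      (X ⋙ Ind.yoneda) ⋙ (Ind.inclusion C ⋙ (evaluation _ _).obj (Opposite.op Z)) :=
  Functor.isoWhiskerLeft X
    (Functor.isoWhiskerRight (Ind.yonedaCompInclusion (C := C)).symm
      ((evaluation _ _).obj (Opposite.op Z)))

/-- The sections of `"lim" X` over `Z`, as a cocone over the sets of maps from `Z` to the terms
of `X`. -/
noncomputable def sectionsCocone (X : ℕ ⥤ C) (Z : C) :
    Cocone (X ⋙ coyoneda.obj (Opposite.op Z)) :=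
  (Cocone.precompose (sectionsIso X Z).hom).obj
    ((Ind.inclusion C ⋙ (evaluation _ _).obj (Opposite.op Z)).mapCocone
      (colimit.cocone (X ⋙ Ind.yoneda)))

/-- Colimits in `Ind C` indexed by `ℕ` are computed sectionwise. -/
noncomputable def isColimitSectionsCocone (X : ℕ ⥤ C) (Z : C) :
    IsColimit (sectionsCocone X Z) :=
  (IsColimit.precomposeHomEquiv (sectionsIso X Z) _).symm
    (isColimitOfPreserves _ (colimit.isColimit _))

theorem subsingleton_sections_of_isZero {Y : Ind C} (hY : IsZero Y) (Z : C) :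
    Subsingleton (((Ind.inclusion C).obj Y).obj (Opposite.op Z)) := by
  refine ⟨fun x y => yonedaEquiv.symm.injective ?_⟩
  rw [← cancel_epi (Ind.yonedaCompInclusion.hom.app Z)]
  obtain ⟨f, hf⟩ := (Ind.inclusion C).map_surjective
    (Ind.yonedaCompInclusion.hom.app Z ≫ yonedaEquiv.symm x)
  obtain ⟨g, hg⟩ := (Ind.inclusion C).map_surjective
    (Ind.yonedaCompInclusion.hom.app Z ≫ yonedaEquiv.symm y)
  rw [← hf, ← hg, hY.eq_of_tgt f g]

/-- An object of `Ind C` whose presheaf has exactly one section over each object is final. -/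
noncomputable def isTerminalOfUniqueSections (Y : Ind C)
    (h : ∀ Z : Cᵒᵖ, Unique (((Ind.inclusion C).obj Y).obj Z)) : IsTerminal Y :=
  IsTerminal.ofUniqueHom
    (fun W => (Ind.inclusion C).preimage
      { app := fun Z => TypeCat.ofHom fun _ => (h Z).default
        naturality := fun _ Z' _ => by
          ext
          exact ((h Z').eq_default _).symm })
    (fun W m => (Ind.inclusion C).map_injective (by
      ext Z x
      exact ((h Z).eq_default _).trans ((h Z).eq_default _).symm))

/-- The formal inductive limit of a sequence vanishes if and only if every term is killed by a
transition map. -/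
theorem isZero_indLim_iff [HasZeroMorphisms C] [HasZeroObject C] (X : ℕ ⥤ C) :
    IsZero (indLim X) ↔ ∀ n, ∃ (m : ℕ) (h : n ≤ m), X.map (homOfLE h) = 0 := by
  constructor
  · intro hX n
    have := subsingleton_sections_of_isZero hX (X.obj n)
    have h : (sectionsCocone X (X.obj n)).ι.app n (𝟙 (X.obj n)) =
        (sectionsCocone X (X.obj n)).ι.app n (0 : X.obj n ⟶ X.obj n) :=
      Subsingleton.elim (α := ((Ind.inclusion C).obj (indLim X)).obj _) _ _
    obtain ⟨m, f, hf⟩ := (Types.FilteredColimit.isColimit_eq_iff'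
      (isColimitSectionsCocone X (X.obj n)) _ _).1 h
    refine ⟨m, leOfHom f, ?_⟩
    have : 𝟙 (X.obj n) ≫ X.map f = 0 ≫ X.map f := hf
    rwa [Category.id_comp, zero_comp] at this
  · intro hX
    have huniq : ∀ Z : Cᵒᵖ, Nonempty (Unique (((Ind.inclusion C).obj (indLim X)).obj Z)) := by
      rintro ⟨Z⟩
      have hc := isColimitSectionsCocone X Z
      refine ⟨⟨⟨(sectionsCocone X Z).ι.app 0 (0 : Z ⟶ X.obj 0)⟩, fun s => ?_⟩⟩
      obtain ⟨n, f, rfl⟩ := Types.jointly_surjective_of_isColimit hc s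
      obtain ⟨m, hm, h⟩ := hX n
      refine (Types.FilteredColimit.isColimit_eq_iff _ hc).2
        ⟨m, homOfLE hm, homOfLE (Nat.zero_le m), ?_⟩
      change (show Z ⟶ X.obj n from f) ≫ X.map _ = (0 : Z ⟶ X.obj 0) ≫ X.map _
      rw [h, comp_zero, zero_comp]
    have h1 : IsTerminal (indLim X) := isTerminalOfUniqueSections _ fun Z => (huniq Z).some
    obtain ⟨Z, hZ⟩ := HasZeroObject.zero (C := C)
    have hI : IsInitial (Ind.yoneda.obj Z) := hZ.isInitial.isInitialObj Ind.yoneda _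
    have hT : IsTerminal (Ind.yoneda.obj Z) := hZ.isTerminal.isTerminalObj Ind.yoneda _
    have h0 : IsZero (Ind.yoneda.obj Z) :=
      ⟨fun Y => ⟨⟨⟨hI.to Y⟩, fun _ => hI.hom_ext _ _⟩⟩,
        fun Y => ⟨⟨⟨hT.from Y⟩, fun _ => hT.hom_ext _ _⟩⟩⟩
    exact h0.of_iso (h1.uniqueUpToIso hT)

end IndLim

/-! ### Contracting homotopies -/

/-- A morphism of complexes which vanishes in cohomology maps cocycles to coboundaries. -/
theorem CochainComplex.exists_d_eq_of_homologyMap_eq_zero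
    {K L : CochainComplex (ModuleCat.{v} ℂ) ℤ} (φ : K ⟶ L) {i' i i'' : ℤ} (hi' : i' + 1 = i)
    (hi'' : i + 1 = i'') (hφ : HomologicalComplex.homologyMap φ i = 0) (x : K.X i)
    (hx : K.d i i'' x = 0) : ∃ y : L.X i', L.d i' i y = φ.f i x := by
  let z : ModuleCat.of ℂ (LinearMap.ker (K.d i i'').hom) ⟶ K.X i :=
    ModuleCat.ofHom (LinearMap.ker (K.d i i'').hom).subtype
  have hz : z ≫ K.d i i'' = 0 := by
    ext w
    exact w.2
  have hnext : (ComplexShape.up ℤ).next i = i'' := by simp [hi'']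
  have hprev : (ComplexShape.up ℤ).prev i = i' := by simp [← hi']
  have hzφ : (z ≫ φ.f i) ≫ L.d i i'' = 0 := by
    rw [Category.assoc, φ.comm, reassoc_of% hz, zero_comp]
  have h0 : L.liftCycles (z ≫ φ.f i) i'' hnext hzφ ≫ L.homologyπ i = 0 := by
    have : L.liftCycles (z ≫ φ.f i) i'' hnext hzφ =
        K.liftCycles z i'' hnext hz ≫ HomologicalComplex.cyclesMap φ i := by
      simp
    rw [this, Category.assoc, ← HomologicalComplex.homologyπ_naturality, hφ, comp_zero, comp_zero]
  obtain ⟨A', π, hπ, x₁, h⟩ :=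
    (L.liftCycles_comp_homologyπ_eq_zero_iff_up_to_refinements i' i i'' hprev hnext _ hzφ).1 h0
  obtain ⟨w, hw⟩ := (ModuleCat.epi_iff_surjective π).1 hπ ⟨x, hx⟩
  refine ⟨x₁ w, ?_⟩
  have := ConcreteCategory.congr_hom h w
  simp only [ModuleCat.comp_apply, hw] at this
  exact this.symm

section DFN

variable {A : Type u} [Ring A] [Algebra ℂ A] [Bornology A]

theorem DFNMod.exists_comp_eq_of_isNuclearMap {E E' F G : DFNMod.{v} A} {u : E ⟶ E'}
    (hu : IsNuclearMap A (DFNMod.Hom.linearMap u)) (f : E' ⟶ F) (d : G ⟶ F)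
    (hfd : ∀ x, ∃ z, DFNMod.Hom.linearMap d z = DFNMod.Hom.linearMap f x) :
    ∃ h : E ⟶ G, h ≫ d = u ≫ f := by
  obtain ⟨h, hh, H⟩ := hu.exists_lift (DFNMod.Hom.linearMap f) f.isBoundedMap
    (DFNMod.Hom.linearMap d) d.isBoundedMap hfd
  exact ⟨⟨⟨h, hh⟩⟩, DFNMod.Hom.ext_linearMap (LinearMap.ext H)⟩

variable {a b : ℤ} (E : ℕ ⥤ ComplexIcc (DFNMod.{v} A) a b)

/-- The transition morphisms of complexes of an inductive system. -/
def transition {n m : ℕ} (h : n ≤ m) : (E.obj n).obj ⟶ (E.obj m).obj :=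
  (E.map (homOfLE h)).hom

theorem transition_comp {n m p : ℕ} (h : n ≤ m) (h' : m ≤ p) :
    transition E h ≫ transition E h' = transition E (h.trans h') := by
  simp only [transition, ← ObjectProperty.FullSubcategory.comp_hom, ← E.map_comp, homOfLE_comp]

/-- If `"lim" H^i` vanishes, then each transition map can be composed with a further one in such
a way that cocycles of degree `i` become coboundaries. -/
theorem exists_transition_cocycle_eq_d {i' i i'' : ℤ} (hi' : i' + 1 = i) (hi'' : i + 1 = i'')
    (hvanish : IsZero (indLim (E ⋙ dfnCohomology A a b i))) (n : ℕ) :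
    ∃ (m : ℕ) (h : n ≤ m), ∀ x, DFNMod.Hom.linearMap ((E.obj n).obj.d i i'') x = 0 →
      ∃ y, DFNMod.Hom.linearMap ((E.obj m).obj.d i' i) y =
        DFNMod.Hom.linearMap ((transition E h).f i) x := by
  obtain ⟨m, h, h0⟩ := (isZero_indLim_iff _).1 hvanish n
  exact ⟨m, h, fun x hx => CochainComplex.exists_d_eq_of_homologyMap_eq_zero
    (((DFNMod.toModuleCat.{v} A).mapHomologicalComplex (ComplexShape.up ℤ)).map
      (transition E h)) hi' hi'' h0 x hx⟩

/-- The transition map from `n` to `m` is homotopic to zero in degrees at least `j`. The maps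
`s p q` are relevant only for `p = q + 1`. -/
def NullHomotopicFrom (j : ℤ) {n m : ℕ} (h : n ≤ m) : Prop :=
  ∃ s : ∀ p q : ℤ, (E.obj n).obj.X p ⟶ (E.obj m).obj.X q,
    ∀ i' i i'' : ℤ, i' + 1 = i → i + 1 = i'' → j ≤ i →
      (transition E h).f i =
        (E.obj n).obj.d i i'' ≫ s i'' i + s i i' ≫ (E.obj m).obj.d i' i

/-- The inductive step: if the homotopy is known in degrees above `j`, the remaining defect in
degree `j` has values in the cocycles, hence in the coboundaries further along the system, and it
lifts through the differential after composition with a nuclear transition map. -/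
theorem exists_nullHomotopicFrom_pred (j : ℤ)
    (hnuc : ∀ n : ℕ, IsNuclearMap A (DFNMod.Hom.linearMap ((transition E n.le_succ).f j)))
    (hvanish : IsZero (indLim (E ⋙ dfnCohomology A a b j)))
    (ih : ∀ n, ∃ (m : ℕ) (h : n ≤ m), NullHomotopicFrom E (j + 1) h) (n : ℕ) :
    ∃ (m : ℕ) (h : n ≤ m), NullHomotopicFrom E j h := by
  obtain ⟨m, hm, s, hs⟩ := ih (n + 1)
  obtain ⟨p, hp, hcob⟩ :=
    exists_transition_cocycle_eq_d E (sub_add_cancel j 1) rfl hvanish m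
  let w : (E.obj (n + 1)).obj.X j ⟶ (E.obj m).obj.X j :=
    (transition E hm).f j - (E.obj (n + 1)).obj.d j (j + 1) ≫ s (j + 1) j
  have hw : w ≫ (E.obj m).obj.d j (j + 1) = 0 := by
    simp only [w, Preadditive.sub_comp, Category.assoc]
    rw [HomologicalComplex.Hom.comm, hs j (j + 1) (j + 1 + 1) rfl rfl le_rfl,
      Preadditive.comp_add, HomologicalComplex.d_comp_d_assoc, zero_comp, zero_add, sub_self]
  obtain ⟨g, hg⟩ := DFNMod.exists_comp_eq_of_isNuclearMap (hnuc n)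
    (w ≫ (transition E hp).f j) ((E.obj p).obj.d (j - 1) j) (fun x => by
      refine hcob (DFNMod.Hom.linearMap w x) ?_
      have := congrArg (fun f => DFNMod.Hom.linearMap f x) hw
      exact this)
  refine ⟨p, n.le_succ.trans (hm.trans hp), fun r q =>
    if h : r = j ∧ q = j - 1 then
      eqToHom (by rw [h.1]) ≫ g ≫ eqToHom (by rw [h.2])
    else (transition E n.le_succ).f r ≫ s r q ≫ (transition E hp).f q, ?_⟩
  intro i' i i'' hi' hi'' hji
  have htrans : (transition E (n.le_succ.trans (hm.trans hp))).f i =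
      (transition E n.le_succ).f i ≫ (transition E hm).f i ≫ (transition E hp).f i := by
    rw [← transition_comp E n.le_succ (hm.trans hp), ← transition_comp E hm hp]
    rfl
  rw [htrans]
  beta_reduce
  rw [dif_neg (by omega)]
  rcases hji.eq_or_lt with rfl | hji
  · obtain rfl : i' = j - 1 := by omega
    obtain rfl : i'' = j + 1 := by omega
    rw [dif_pos ⟨rfl, rfl⟩]
    simp only [eqToHom_refl, Category.id_comp, Category.comp_id, hg, w, Preadditive.sub_comp,
      Preadditive.comp_sub, Category.assoc, HomologicalComplex.Hom.comm_assoc]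
    abel
  · rw [dif_neg (by omega), hs i' i i'' hi' hi'' hji]
    simp only [Preadditive.comp_add, Preadditive.add_comp, Category.assoc,
      HomologicalComplex.Hom.comm_assoc, HomologicalComplex.Hom.comm]

/-- Under the assumptions of nuclearity and acyclicity, every term of the system is sent to a
further term by a transition morphism which is homotopic to zero. -/
theorem exists_homotopy_transition_zero
    (hnuc : ∀ (i : ℤ) (n : ℕ),
      IsNuclearMap A (DFNMod.Hom.linearMap ((transition E n.le_succ).f i)))
    (hvanish : ∀ i : ℤ, IsZero (indLim (E ⋙ dfnCohomology A a b i))) (n : ℕ) :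
    ∃ (m : ℕ) (h : n ≤ m), Nonempty (Homotopy (transition E h) 0) := by
  have key : ∀ (k n : ℕ), ∃ (m : ℕ) (h : n ≤ m), NullHomotopicFrom E (b + 1 - k) h := by
    intro k
    induction k with
    | zero =>
      exact fun n => ⟨n, le_rfl, fun _ _ => 0, fun i' i i'' _ _ hi =>
        ((E.obj n).property i (by simp at hi ⊢; omega)).eq_of_src _ _⟩
    | succ k ih =>
      refine exists_nullHomotopicFrom_pred E _ (hnuc _) (hvanish _) ?_
      have hk : b + 1 - ((k + 1 : ℕ) : ℤ) + 1 = b + 1 - (k : ℤ) := by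
        push_cast
        ring
      rwa [hk]
  obtain ⟨m, h, s, hs⟩ := key (b + 1 - a).toNat n
  refine ⟨m, h, ⟨(Homotopy.ofEq ?_).trans (Homotopy.nullHomotopy' fun p q _ => s p q)⟩⟩
  ext1 i
  rw [Homotopy.nullHomotopicMap'_f (c := ComplexShape.up ℤ) (k₂ := i - 1) (k₁ := i)
    (k₀ := i + 1) (by simp) (by simp)]
  by_cases hi : a ≤ i
  · exact hs _ _ _ (by omega) rfl (by omega)
  · exact ((E.obj n).property i (by simp; omega)).eq_of_src _ _

end DFN

theorem theorem4p4 {A : Type u} [Ring A] [Algebra ℂ A] [Bornology A] [IsDFNAlgebra A]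
    (a b : ℤ) (hab : a ≤ b) (E : ℕ ⥤ ComplexIcc (DFNMod.{v} A) a b)
    (hnuc : ∀ (i : ℤ) (n : ℕ),
      IsNuclearMap A (DFNMod.Hom.linearMap ((E.map (homOfLE n.le_succ)).hom.f i)))
    (hvanish : ∀ i : ℤ, IsZero (indLim (E ⋙ dfnCohomology A a b i))) :
    IsZero (indLim (E ⋙ toHomotopyIcc (DFNMod.{v} A) a b)) := by
  -- the terms of degree `b + 1` of complexes concentrated in `[a, b]` are zero objects
  have : HasZeroObject (DFNMod.{v} A) :=
    ((E.obj 0).property (b + 1) (by simp)).hasZeroObject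
  obtain ⟨K, hK⟩ := HasZeroObject.zero (C := CochainComplex (DFNMod.{v} A) ℤ)
  let Z : HomotopyIcc (DFNMod.{v} A) a b :=
    ⟨(HomotopyCategory.quotient _ _).obj K, fun i _ =>
      (HomologicalComplex.eval _ _ i).map_isZero hK⟩
  have hZ : IsZero Z := by
    rw [IsZero.iff_id_eq_zero]
    ext1
    exact ((HomotopyCategory.quotient (DFNMod.{v} A) (ComplexShape.up ℤ)).map_isZero
      hK).eq_of_src (𝟙 _) 0
  have : HasZeroObject (HomotopyIcc (DFNMod.{v} A) a b) := hZ.hasZeroObject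
  refine (isZero_indLim_iff _).2 fun n => ?_
  obtain ⟨m, h, hh⟩ := exists_homotopy_transition_zero E hnuc hvanish n
  refine ⟨m, h, ?_⟩
  ext1
  exact (HomotopyCategory.quotient_map_eq_zero_iff _).2 hh
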